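/- For $N\ge 1$ spins on a ring (site indices modulo $N$) let $$\mathcal H(\{h_j\})=-\sum_{j=1}^N\sigma^x_j\sigma^x_{j+1}+\sum_{j=1}^N h_j\sigma^z_j ,$$ let $\psi_0=(|{\rightarrow}\cdots{\rightarrow}\rangle+|{\leftarrow}\cdots{\leftarrow}\rangle)/\sqrt2$ be the even-parity ground state of $\mathcal H(\{0\})$, and for an operator $A$ put $\langle A\rangle_{\{h_j\}}(t)=\langle\psi(t)|A|\psi(t)\rangle$ with $\psi(t)=e^{-it\mathcal H(\{h_j\})}\psi_0$. Let $c_j=\bigl(\prod_{l<j}\sigma^z_l\bigr)(\sigma^x_j+i\sigma^y_j)/2$ be the Jordan–Wigner fermions. Fix $h>1$. Consider perturbations $h_j=h+\delta_j$ of the homogeneous post-quench field $h$ whose Fourier components $V_q=\frac1N\sum_j\delta_j e^{-iqj}$, $q=2\pi p/N$, vanish unless (up to reciprocal lattice vectors) $|p|\le P$, and satisfy $|V_q|\le K N^{-3}$, where $P$ and $K$ do not depend on $N$ (that is, $q=O(1/N)$ and $V_q=O(N^{-3})$). Write $\Delta\langle A\rangle=\langle A\rangle_{\{h+\delta_j\}}(t)-\langle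 A\rangle_{\{h\}}(t)$ for the change relative to the homogeneous case. Then, for every $T$, the following bounds hold uniformly in $N$, in all such perturbations $\delta$ and in all times $|t|\le T N^2$ (in particular at every time $t$ that is fixed independently of $N$), with implied constants depending only on $h,P,K,T$ (and on $d$ in the last item). 1. Every two-point fermionic correlator changes by $O(1/N)$: uniformly in the sites $i,j$, $$\Delta\langle c_ic_j\rangle,\ \Delta\langle c_ic_j^\dagger\rangle,\ \Delta\langle c_i^\dagger c_j\rangle,\ \Delta\langle c_i^\dagger c_j^\dagger\rangle=O(N^{-1}),$$ and more generally $\Delta\langle ab\rangle=O(N^{-1})$ for all normalized modes $a,b$ of the form $\sum_i(u_ic_i+v_ic_i^\dagger)$ with $\sum_i(|u_i|^2+|v_i|^2)=1$. 2. $\Delta\langle\sigma^z_i\sigma^z_j\rangle=O(N^{-1})$, uniformly in the sites $i,j$. 3. For every distance $d$ fixed independently of $N$, $\Delta\langle\sigma^x_i\sigma^x_j\rangle=O(N^{-1})$, uniformly in the pairs of sites $i,j$ at distance $d$ along the ring. -/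

import Mathlib

open scoped Matrix

noncomputable section

namespace IsingChain

/-- Basis configurations of `N` spins-1/2 in the `σᶻ` basis: `0` is spin up (`σᶻ = 1`),
`1` is spin down (`σᶻ = -1`). -/
abbrev Config (N : ℕ) : Type := Fin N → Fin 2

/-- Operators on the `2 ^ N`-dimensional space of the chain, in the configuration basis. -/
abbrev Op (N : ℕ) : Type := Matrix (Config N) (Config N) ℂ

/-- State vectors of the chain. -/
abbrev State (N : ℕ) : Type := Config N → ℂ

/-- The operator acting as the `2 × 2` matrix `a` on site `i` and trivially elsewhere. -/
def siteOp {N : ℕ} (i : Fin N) (a : Matrix (Fin 2) (Fin 2) ℂ) : Op N :=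
  Matrix.of fun s s' => if ∀ k, k ≠ i → s k = s' k then a (s i) (s' i) else 0

/-- The Pauli operator `σˣ` on site `i`. -/
def sigmaX {N : ℕ} (i : Fin N) : Op N := siteOp i !![0, 1; 1, 0]

/-- The Pauli operator `σᶻ` on site `i`. -/
def sigmaZ {N : ℕ} (i : Fin N) : Op N := siteOp i !![1, 0; 0, -1]

/-- The transverse-field Ising Hamiltonian `- ∑ σˣᵢ σˣᵢ₊₁ + ∑ hᵢ σᶻᵢ` with periodic boundary
conditions (addition in `Fin N` is modulo `N`). -/
def hamiltonian {N : ℕ} [NeZero N] (h : Fin N → ℝ) : Op N :=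
  - ∑ i : Fin N, sigmaX i * sigmaX (i + 1) + ∑ i : Fin N, (h i : ℂ) • sigmaZ i

/-- All spins polarized along `+x`. -/
def rightState (N : ℕ) : State N := fun _ => ∏ _i : Fin N, ((1 / Real.sqrt 2 : ℝ) : ℂ)

/-- All spins polarized along `-x`. -/
def leftState (N : ℕ) : State N :=
  fun s => ∏ i : Fin N, ((-1) ^ (s i : ℕ) * ((1 / Real.sqrt 2 : ℝ) : ℂ))

/-- The initial state `(|→⟩ + |←⟩) / √2`: the ground state of the chain without field in the
sector with an even number of fermions. -/
def initialState (N : ℕ) : State N :=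
  ((1 / Real.sqrt 2 : ℝ) : ℂ) • (rightState N + leftState N)

/-- The state `exp (- i t H) ψ(0)` at time `t` after the quench to the Hamiltonian with
fields `h`. -/
def stateAt {N : ℕ} [NeZero N] (h : Fin N → ℝ) (t : ℝ) : State N :=
  NormedSpace.exp ((-(Complex.I * (t : ℂ))) • hamiltonian h) *ᵥ initialState N

/-- The expectation value `⟨ψ(t)| A |ψ(t)⟩` after the quench to the fields `h`. -/
def expect {N : ℕ} [NeZero N] (h : Fin N → ℝ) (t : ℝ) (A : Op N) : ℂ :=
  star (stateAt h t) ⬝ᵥ (A *ᵥ stateAt h t)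

/-- The change of `⟨A⟩` at time `t` caused by the perturbation `∑ δⱼ σᶻⱼ` of the post-quench
Hamiltonian with homogeneous field `h`. -/
def change {N : ℕ} [NeZero N] (h : ℝ) (δ : Fin N → ℝ) (t : ℝ) (A : Op N) : ℂ :=
  expect (fun j => h + δ j) t A - expect (fun _ => h) t A

/-- The Jordan–Wigner fermion annihilation operator
`cᵢ = (∏_{j < i} σᶻⱼ) · (σˣᵢ + i σʸᵢ) / 2`, so that `σᶻᵢ = 1 - 2 cᵢ† cᵢ`. -/
def annihilate {N : ℕ} (i : Fin N) : Op N :=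
  Matrix.diagonal (fun s => ∏ j ∈ Finset.univ.filter (fun j => j < i), (-1 : ℂ) ^ (s j : ℕ)) *
    siteOp i !![0, 1; 0, 0]

/-- The Jordan–Wigner fermion creation operator `cᵢ†`. -/
def create {N : ℕ} (i : Fin N) : Op N := (annihilate i)ᴴ

/-- The operator `∑ᵢ (uᵢ cᵢ + vᵢ cᵢ†)`. -/
def fermionMode {N : ℕ} (u v : Fin N → ℂ) : Op N :=
  ∑ i : Fin N, (u i • annihilate i + v i • create i)

/-- Normalization of the coefficients of a mode: `∑ᵢ (|uᵢ|² + |vᵢ|²) = 1`. The members of every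
basis that is related to the `cᵢ, cᵢ†` by a unitary `2N × 2N` matrix are of this form. -/
def IsNormalized {N : ℕ} (u v : Fin N → ℂ) : Prop :=
  ∑ i : Fin N, (‖u i‖ ^ 2 + ‖v i‖ ^ 2) = 1

/-- The Fourier component `V_q = N⁻¹ ∑ⱼ δⱼ exp (- i q j)` at `q = 2 π p / N`, so that
`δⱼ = ∑_q V_q exp (i q j)`, the sum being over the Brillouin zone. -/
def fourierComponent {N : ℕ} (δ : Fin N → ℝ) (p : ℤ) : ℂ :=
  (N : ℂ)⁻¹ * ∑ j : Fin N, (δ j : ℂ) *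
    Complex.exp (-(Complex.I * (2 * (Real.pi : ℂ) * (p : ℂ) / (N : ℂ)) * ((j : ℕ) : ℂ)))

/-- All Fourier components of `δ` have size at most `K N⁻³`, and they vanish unless, up to
reciprocal lattice vectors, `q = 2 π p / N` with `|p| ≤ P`. -/
def IsLongWave {N : ℕ} (P : ℕ) (K : ℝ) (δ : Fin N → ℝ) : Prop :=
  (∀ p : ℤ, ‖fourierComponent δ p‖ ≤ K / (N : ℝ) ^ 3) ∧
  ∀ p : ℤ, (∀ m : ℤ, |m| ≤ (P : ℤ) → ¬ p ≡ m [ZMOD (N : ℤ)]) → fourierComponent δ p = 0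

end IsingChain

end

/-! ### One-site operators, parities and the Jordan–Wigner transformation. -/

noncomputable section SiteOperators

namespace IsingChain

open Matrix

variable {N : ℕ}

/-! The perturbation has many-body norm up to `∑ |δⱼ|`, so comparing the two evolutions on the whole
state space would give only `O(1)` at `|t| ~ N²`. The missing factor `1/N` comes from free fermions.
On states of even parity the chain is a quadratic form in `2N` Majorana operators with antiperiodic
boundary conditions (`sigmaX_mul_sigmaX_succ`, `hamiltonian_mul_evenProj`), and the initial state is
even. The commutator with such a form acts linearly on modes, so a mode evolves by a unitary group
on its `2N` coefficients (`heisenberg_mode`).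

The self-adjoint one-particle generator changes by at most `2 max |δⱼ|` in norm, a maximum and not a
sum (`norm_modeGenerator_isingForm_sub_le`). Fourier inversion over at most `2P + 1` wave numbers
gives `max |δⱼ| ≤ (2P + 1) K / N³` (`IsLongWave.abs_le`), and Duhamel's formula makes the unitary
groups differ by `O(|t| N⁻³) = O(1/N)` (`norm_exp_sub_exp_le`). The anticommutation relations bound
a mode in operator norm by the `ℓ²` norm of its coefficients, with no dependence on `N`
(`norm_sum_majorana_le`), so the estimate carries over to modes.

All observables in question are, up to a conserved parity factor, products of boundedly many modes,
and a Leibniz rule for operators of even parity (`IsStable.mul`) propagates the bound to them. -/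

lemma siteOp_apply (i : Fin N) (a : Matrix (Fin 2) (Fin 2) ℂ) (s s' : Config N) :
    siteOp i a s s' = if ∀ k, k ≠ i → s k = s' k then a (s i) (s' i) else 0 := rfl

lemma siteOp_add (i : Fin N) (a b : Matrix (Fin 2) (Fin 2) ℂ) :
    siteOp i (a + b) = siteOp i a + siteOp i b := by
  ext s s'
  simp only [siteOp_apply, Matrix.add_apply]
  split_ifs <;> simp

lemma siteOp_smul (i : Fin N) (z : ℂ) (a : Matrix (Fin 2) (Fin 2) ℂ) :
    siteOp i (z • a) = z • siteOp i a := by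
  ext s s'
  simp only [siteOp_apply, Matrix.smul_apply]
  split_ifs <;> simp

lemma siteOp_zero (i : Fin N) : siteOp i (0 : Matrix (Fin 2) (Fin 2) ℂ) = 0 := by
  ext s s'
  simp [siteOp_apply]

lemma siteOp_one (i : Fin N) : siteOp i (1 : Matrix (Fin 2) (Fin 2) ℂ) = 1 := by
  ext s s'
  rw [siteOp_apply, Matrix.one_apply, Matrix.one_apply]
  by_cases h : s = s'
  · simp [h]
  · rw [if_neg h]
    split_ifs with h1 h2
    · exact absurd (funext fun k => by
        by_cases hk : k = i
        · exact hk ▸ h2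
        · exact h1 k hk) h
    · rfl
    · rfl

lemma siteOp_conjTranspose (i : Fin N) (a : Matrix (Fin 2) (Fin 2) ℂ) :
    (siteOp i a)ᴴ = siteOp i aᴴ := by
  ext s s'
  simp only [siteOp_apply, Matrix.conjTranspose_apply]
  by_cases h : ∀ k, k ≠ i → s k = s' k
  · rw [if_pos h, if_pos fun k hk => (h k hk).symm]
  · rw [if_neg h, if_neg fun h' => h fun k hk => (h' k hk).symm, star_zero]

/-- Left multiplication by a one-site operator. -/
lemma siteOp_mul_apply (i : Fin N) (a : Matrix (Fin 2) (Fin 2) ℂ) (A : Op N) (s s' : Config N) :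
    (siteOp i a * A) s s' = ∑ x : Fin 2, a (s i) x * A (Function.update s i x) s' := by
  rw [Matrix.mul_apply]
  symm
  refine Finset.sum_of_injOn (fun x => Function.update s i x) ?_ ?_ ?_ ?_
  · intro x _ y _ hxy
    simpa using congrFun hxy i
  · simp
  · intro s'' _ hs
    rw [siteOp_apply, if_neg, zero_mul]
    intro h
    apply hs
    refine ⟨s'' i, by simp, ?_⟩
    funext k
    by_cases hk : k = i
    · subst hk; simp
    · simp [Function.update_of_ne hk, h k hk]
  · intro x _
    rw [siteOp_apply, if_pos, Function.update_self]
    intro k hk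
    rw [Function.update_of_ne hk]

lemma siteOp_mul_siteOp (i : Fin N) (a b : Matrix (Fin 2) (Fin 2) ℂ) :
    siteOp i a * siteOp i b = siteOp i (a * b) := by
  ext s s'
  rw [siteOp_mul_apply]
  simp only [siteOp_apply, Function.update_self, Matrix.mul_apply]
  have : ∀ x : Fin 2, (∀ k, k ≠ i → Function.update s i x k = s' k) ↔ ∀ k, k ≠ i → s k = s' k :=
    fun x => forall₂_congr fun k hk => by rw [Function.update_of_ne hk]
  simp only [this]
  split_ifs <;> simp

lemma siteOp_commute {i j : Fin N} (hij : i ≠ j) (a b : Matrix (Fin 2) (Fin 2) ℂ) :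
    siteOp i a * siteOp j b = siteOp j b * siteOp i a := by
  -- The entries are symmetric in the two sites, so one formula computes both orders of the product.
  have key : ∀ (i j : Fin N), i ≠ j → ∀ (a b : Matrix (Fin 2) (Fin 2) ℂ) (s s' : Config N),
      (siteOp i a * siteOp j b) s s' =
        if ∀ k, k ≠ i → k ≠ j → s k = s' k then a (s i) (s' i) * b (s j) (s' j) else 0 := by
    intro i j hij a b s s'
    rw [siteOp_mul_apply, Finset.sum_eq_single (s' i)]
    · rw [siteOp_apply, Function.update_of_ne hij.symm, ← mul_ite_zero]
      congr 1
      refine if_congr ⟨fun h k hi hj => ?_, fun h k hj => ?_⟩ rfl rfl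
      · simpa [Function.update_of_ne hi] using h k hj
      · by_cases hk : k = i
        · subst hk; simp
        · simpa [Function.update_of_ne hk] using h k hk hj
    · intro x _ hx
      rw [siteOp_apply, if_neg, mul_zero]
      intro h
      exact hx (by simpa using h i hij)
    · simp
  ext s s'
  rw [key i j hij, key j i hij.symm, mul_comm (a _ _)]
  refine if_congr ⟨fun h k hj hi => h k hi hj, fun h k hi hj => h k hj hi⟩ rfl rfl

/-- The parity `∏ σᶻⱼ` of the spins on a set of sites. -/
def parityOn (I : Finset (Fin N)) : Op N :=
  Matrix.diagonal fun s => ∏ j ∈ I, (-1 : ℂ) ^ (s j : ℕ)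

lemma parityOn_mul_self (I : Finset (Fin N)) : parityOn I * parityOn I = 1 := by
  rw [parityOn, Matrix.diagonal_mul_diagonal, ← Matrix.diagonal_one]
  congr 1
  funext s
  rw [← Finset.prod_mul_distrib]
  exact Finset.prod_eq_one fun j _ => by rw [← mul_pow]; simp

lemma parityOn_conjTranspose (I : Finset (Fin N)) : (parityOn I)ᴴ = parityOn I := by
  rw [parityOn, Matrix.diagonal_conjTranspose]
  congr 1
  funext s
  simp

lemma parityOn_comm (I J : Finset (Fin N)) : parityOn I * parityOn J = parityOn J * parityOn I := by
  simp only [parityOn, Matrix.diagonal_mul_diagonal, mul_comm]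

lemma parityOn_empty : parityOn (∅ : Finset (Fin N)) = 1 := by
  simp [parityOn]

lemma parityOn_insert {I : Finset (Fin N)} {i : Fin N} (hi : i ∉ I) :
    parityOn (insert i I) = parityOn I * siteOp i !![1, 0; 0, -1] := by
  ext s s'
  rw [parityOn, parityOn, Matrix.diagonal_mul, Matrix.diagonal_apply, siteOp_apply]
  by_cases h : s = s'
  · subst h
    rw [if_pos rfl, if_pos fun _ _ => rfl, Finset.prod_insert hi, mul_comm]
    congr 1
    generalize s i = x
    fin_cases x <;> simp
  · rw [if_neg h]
    split_ifs with h1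
    · have h2 : s i ≠ s' i := fun h2 => h (funext fun k => by
        by_cases hk : k = i
        · exact hk ▸ h2
        · exact h1 k hk)
      revert h2
      generalize s i = x
      generalize s' i = y
      fin_cases x <;> fin_cases y <;> simp
    · simp

lemma parityOn_siteOp_of_notMem {I : Finset (Fin N)} {i : Fin N} (hi : i ∉ I)
    (a : Matrix (Fin 2) (Fin 2) ℂ) : parityOn I * siteOp i a = siteOp i a * parityOn I := by
  ext s s'
  rw [parityOn, Matrix.diagonal_mul, Matrix.mul_diagonal, siteOp_apply, mul_comm]
  split_ifs with h
  · congr 1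
    exact Finset.prod_congr rfl fun j hj => by rw [h j fun hji => hi (hji ▸ hj)]
  · simp

/-- Only the factor `σᶻ` at site `i` matters: it anticommutes with every off-diagonal matrix, and
the other factors of the string commute. -/
lemma parityOn_siteOp_of_mem {I : Finset (Fin N)} {i : Fin N} (hi : i ∈ I) (x y : ℂ) :
    parityOn I * siteOp i !![0, x; y, 0] = -(siteOp i !![0, x; y, 0] * parityOn I) := by
  rw [← Finset.insert_erase hi, parityOn_insert (Finset.notMem_erase i I), mul_assoc,
    siteOp_mul_siteOp, ← mul_assoc, ← parityOn_siteOp_of_notMem (Finset.notMem_erase i I),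
    mul_assoc, siteOp_mul_siteOp, ← mul_neg]
  congr 1
  rw [← neg_one_smul ℂ (siteOp _ _), ← siteOp_smul]
  congr 1
  ext a b
  fin_cases a <;> fin_cases b <;> simp [Matrix.mul_apply]

/-- The Jordan–Wigner string to the left of site `i`. -/
def jwString (i : Fin N) : Op N := parityOn (Finset.univ.filter (fun j => j < i))

/-- The operator acting as the off-diagonal matrix with entries `x`, `y` on site `i`, dressed with
the Jordan–Wigner string. -/
def jwOp (i : Fin N) (x y : ℂ) : Op N := jwString i * siteOp i !![0, x; y, 0]

lemma jwString_siteOp (i : Fin N) (a : Matrix (Fin 2) (Fin 2) ℂ) :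
    jwString i * siteOp i a = siteOp i a * jwString i :=
  parityOn_siteOp_of_notMem (by simp) a

lemma jwString_mul_self (i : Fin N) : jwString i * jwString i = 1 := parityOn_mul_self _

lemma offDiag_mul (x y x' y' : ℂ) :
    (!![0, x; y, 0] * !![0, x'; y', 0] : Matrix (Fin 2) (Fin 2) ℂ) = !![x * y', 0; 0, y * x'] := by
  ext a b
  fin_cases a <;> fin_cases b <;> simp [Matrix.mul_apply]

lemma jwOp_mul_self_site (i : Fin N) (x y x' y' : ℂ) :
    jwOp i x y * jwOp i x' y' = siteOp i !![x * y', 0; 0, y * x'] := by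
  rw [jwOp, jwOp, jwString_siteOp, mul_assoc, ← mul_assoc (jwString i), jwString_mul_self, one_mul,
    siteOp_mul_siteOp, offDiag_mul]

/-- The string of `j` covers site `i`, whereas that of `i` does not reach `j`: exactly one sign
arises. -/
lemma jwOp_anticommute_of_lt {i j : Fin N} (hij : i < j) (x y x' y' : ℂ) :
    jwOp i x y * jwOp j x' y' = -(jwOp j x' y' * jwOp i x y) := by
  have h1 : siteOp i !![0, x; y, 0] * jwString j = -(jwString j * siteOp i !![0, x; y, 0]) := by
    rw [jwString, parityOn_siteOp_of_mem (by simpa using hij), neg_neg]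
  have h2 : jwString i * siteOp j !![0, x'; y', 0] = siteOp j !![0, x'; y', 0] * jwString i :=
    parityOn_siteOp_of_notMem (by simpa using hij.le) _
  have h3 : jwString i * jwString j = jwString j * jwString i := parityOn_comm _ _
  calc jwOp i x y * jwOp j x' y'
      = jwString i * (siteOp i !![0, x; y, 0] * jwString j) * siteOp j !![0, x'; y', 0] := by
        simp only [jwOp, mul_assoc]
    _ = -(jwString i * jwString j * (siteOp i !![0, x; y, 0] * siteOp j !![0, x'; y', 0])) := by
        rw [h1]; simp only [mul_neg, neg_mul, mul_assoc]
    _ = -(jwString j * (jwString i * siteOp j !![0, x'; y', 0]) * siteOp i !![0, x; y, 0]) := by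
        rw [h3, siteOp_commute hij.ne]; simp only [mul_assoc]
    _ = -(jwOp j x' y' * jwOp i x y) := by
        rw [h2]; simp only [jwOp, mul_assoc]

lemma jwOp_anticommute {i j : Fin N} (hij : i ≠ j) (x y x' y' : ℂ) :
    jwOp i x y * jwOp j x' y' = -(jwOp j x' y' * jwOp i x y) := by
  rcases hij.lt_or_gt with h | h
  · exact jwOp_anticommute_of_lt h _ _ _ _
  · rw [jwOp_anticommute_of_lt h x' y' x y, neg_neg]

lemma jwOp_add (i : Fin N) (x y x' y' : ℂ) :
    jwOp i x y + jwOp i x' y' = jwOp i (x + x') (y + y') := by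
  rw [jwOp, jwOp, jwOp, ← mul_add, ← siteOp_add]
  congr 2
  ext a b
  fin_cases a <;> fin_cases b <;> simp

lemma jwOp_smul (i : Fin N) (z x y : ℂ) : z • jwOp i x y = jwOp i (z * x) (z * y) := by
  rw [jwOp, jwOp, ← mul_smul_comm, ← siteOp_smul]
  congr 2
  ext a b
  fin_cases a <;> fin_cases b <;> simp

lemma jwOp_conjTranspose (i : Fin N) (x y : ℂ) : (jwOp i x y)ᴴ = jwOp i (star y) (star x) := by
  rw [jwOp, Matrix.conjTranspose_mul, siteOp_conjTranspose, jwString, parityOn_conjTranspose,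
    ← jwString, ← jwString_siteOp, jwOp]
  congr 2
  ext a b
  fin_cases a <;> fin_cases b <;> simp

lemma annihilate_eq_jwOp (i : Fin N) : annihilate i = jwOp i 1 0 := rfl

lemma create_eq_jwOp (i : Fin N) : create i = jwOp i 0 1 := by
  rw [create, annihilate_eq_jwOp, jwOp_conjTranspose, star_zero, star_one]

/-- The Majorana operators `cᵢ + cᵢ†` (left summand) and `-i (cᵢ - cᵢ†)` (right summand). -/
def majorana : Fin N ⊕ Fin N → Op N
  | .inl i => jwOp i 1 1
  | .inr i => jwOp i (-Complex.I) Complex.I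

lemma majorana_conjTranspose (k : Fin N ⊕ Fin N) : (majorana k)ᴴ = majorana k := by
  rcases k with i | i <;> simp [majorana, jwOp_conjTranspose]

lemma majorana_anticommute (k l : Fin N ⊕ Fin N) :
    majorana k * majorana l + majorana l * majorana k = if k = l then (2 : ℂ) • (1 : Op N) else 0 := by
  have hadd (x y x' y' : ℂ) :
      (!![x, 0; 0, y] + !![x', 0; 0, y'] : Matrix (Fin 2) (Fin 2) ℂ) =
        !![x + x', 0; 0, y + y'] := by
    ext a b
    fin_cases a <;> fin_cases b <;> simp
  have htwo : (!![2, 0; 0, 2] : Matrix (Fin 2) (Fin 2) ℂ) = (2 : ℂ) • 1 := by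
    ext a b
    fin_cases a <;> fin_cases b <;> simp
  have hzero : (!![0, 0; 0, 0] : Matrix (Fin 2) (Fin 2) ℂ) = 0 := by
    ext a b
    fin_cases a <;> fin_cases b <;> simp
  rcases k with i | i <;> rcases l with j | j <;> by_cases hij : i = j
  any_goals
    simp only [majorana, Sum.inl.injEq, Sum.inr.injEq, hij, reduceCtorEq, if_false]
    rw [jwOp_anticommute hij, neg_add_cancel]
  all_goals
    subst hij
    simp only [majorana, jwOp_mul_self_site, ← siteOp_add, hadd, reduceCtorEq, if_false, if_true]
    norm_num [hzero, htwo, siteOp_smul, siteOp_one, siteOp_zero]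

/-- The total parity `∏ σᶻⱼ`. -/
def parity (N : ℕ) : Op N := parityOn Finset.univ

lemma parity_jwOp (i : Fin N) (x y : ℂ) : parity N * jwOp i x y = -(jwOp i x y * parity N) := by
  rw [jwOp, ← mul_assoc, parity, jwString, parityOn_comm, mul_assoc,
    parityOn_siteOp_of_mem (Finset.mem_univ i), mul_neg, mul_assoc]

lemma parity_majorana (k : Fin N ⊕ Fin N) :
    parity N * majorana k = -(majorana k * parity N) := by
  rcases k with i | i <;> exact parity_jwOp _ _ _

lemma sigmaZ_eq (i : Fin N) :
    sigmaZ i = (-Complex.I) • (majorana (.inl i) * majorana (.inr i)) := by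
  rw [majorana, majorana, jwOp_mul_self_site, sigmaZ, ← siteOp_smul]
  congr 1
  ext a b
  fin_cases a <;> fin_cases b <;> simp

/-- The sign of the bond between `i` and `i + 1` in the sector with an even number of fermions:
the boundary conditions of the fermions are antiperiodic. -/
def bondSign [NeZero N] (i : Fin N) : ℝ := if i + 1 = 0 then -1 else 1

/-- The fermionic form of `σˣᵢ σˣᵢ₊₁` in the even sector. -/
def bond [NeZero N] (i : Fin N) : Op N :=
  (-Complex.I * bondSign i) • (majorana (.inr i) * majorana (.inl (i + 1)))

/-- Strings of neighbouring sites differ by `σᶻᵢ`, which turns `σʸᵢ` into `i σˣᵢ`. On the closing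
bond the string of site `0` is empty and that of the last site lacks one `σᶻ` to be the total
parity. Moving this parity past `σˣ` produces the antiperiodic sign. Operators on the two sites are
never interchanged, so `N = 1`, where they coincide, is covered. -/
lemma sigmaX_mul_sigmaX_succ [NeZero N] (i : Fin N) :
    sigmaX i * sigmaX (i + 1) = bond i * if i + 1 = 0 then parity N else 1 := by
  have hmul : siteOp i !![0, -Complex.I; Complex.I, 0] * siteOp i !![1, 0; 0, -1] =
      Complex.I • sigmaX i := by
    rw [siteOp_mul_siteOp, sigmaX, ← siteOp_smul]
    congr 1
    ext a b
    fin_cases a <;> fin_cases b <;> simp [Matrix.mul_apply]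
  have hS : jwString i * siteOp i !![0, -Complex.I; Complex.I, 0] *
      (jwString i * siteOp i !![1, 0; 0, -1]) = Complex.I • sigmaX i := by
    rw [jwString_siteOp, mul_assoc, ← mul_assoc (jwString i), jwString_mul_self, one_mul, hmul]
  have hval : ((i + 1 : Fin N) : ℕ) = ((i : ℕ) + 1) % N := by
    rw [Fin.val_add, Fin.val_one', Nat.add_mod_mod]
  have hlast : i + 1 = 0 → (i : ℕ) + 1 = N := by
    intro h
    have h1 := congrArg Fin.val h
    rw [hval, Fin.val_zero] at h1
    have := Nat.dvd_of_mod_eq_zero h1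
    exact le_antisymm i.2 (Nat.le_of_dvd (Nat.succ_pos _) this)
  have hnext : i + 1 ≠ 0 → ((i + 1 : Fin N) : ℕ) = i + 1 := by
    intro h
    have h1 : ((i + 1 : Fin N) : ℕ) ≠ 0 := fun h' => h (Fin.ext h')
    rw [hval] at h1 ⊢
    refine Nat.mod_eq_of_lt (lt_of_le_of_ne i.2 fun h2 => h1 ?_)
    rw [h2, Nat.mod_self]
  by_cases h : i + 1 = 0
  · have hZ : parity N = jwString i * siteOp i !![1, 0; 0, -1] := by
      rw [parity, jwString, ← parityOn_insert (by simp)]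
      congr 1
      ext j
      have := hlast h
      simp only [Finset.mem_univ, Finset.mem_insert, Finset.mem_filter, true_and, true_iff,
        Fin.ext_iff, Fin.lt_def]
      omega
    have hS0 : jwString (i + 1) = 1 := by
      rw [h, jwString, ← parityOn_empty]
      congr 1
      ext j
      simp
    have hX : siteOp (i + 1) !![0, 1; 1, 0] * parity N = -(parity N * sigmaX (i + 1)) := by
      rw [parity, sigmaX, parityOn_siteOp_of_mem (Finset.mem_univ _), neg_neg]
    rw [if_pos h, bond, bondSign, if_pos h, majorana, majorana, jwOp, jwOp, hS0, one_mul,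
      smul_mul_assoc, mul_assoc, hX, hZ, mul_neg, ← mul_assoc, hS, smul_mul_assoc, ← smul_neg,
      smul_smul, smul_neg, ← neg_smul]
    simp
  · have hZ : jwString (i + 1) = jwString i * siteOp i !![1, 0; 0, -1] := by
      rw [jwString, jwString, ← parityOn_insert (by simp)]
      congr 1
      ext j
      have := hnext h
      simp only [Finset.mem_univ, Finset.mem_insert, Finset.mem_filter, true_and,
        Fin.ext_iff, Fin.lt_def]
      omega
    rw [if_neg h, bond, bondSign, if_neg h, majorana, majorana, jwOp, jwOp, hZ, ← mul_assoc, hS,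
      mul_one, smul_mul_assoc, smul_smul, ← sigmaX]
    simp

end IsingChain

end SiteOperators

/-! ### Exponentials in Banach and C⋆-algebras. -/

section Analysis

open NormedSpace

variable {A : Type*}

lemma exp_smul_mul_exp_neg_smul [NormedRing A] [NormedAlgebra ℂ A] [CompleteSpace A] (x : A)
    (z : ℂ) : exp (z • x) * exp (-(z • x)) = 1 := by
  let _ : NormedAlgebra ℚ A := NormedAlgebra.restrictScalars ℚ ℂ A
  rw [← exp_add_of_commute (Commute.neg_right (Commute.refl _)), add_neg_cancel, exp_zero]

/-- If the commutator with `H` acts on the elements `φ w` through `M`, then conjugation by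
`exp (z H)` acts on them through `exp (z M)`. -/
lemma exp_mul_map_eq_map_exp_mul [NormedRing A] [NormedAlgebra ℂ A] [CompleteSpace A]
    {E : Type*} [NormedAddCommGroup E] [NormedSpace ℂ E] [CompleteSpace E] (φ : E →L[ℂ] A)
    (M : E →L[ℂ] E) (H : A) (hM : ∀ w, H * φ w = φ w * H + φ (M w)) (z : ℂ) (w : E) :
    exp (z • H) * φ w = φ (exp (z • M) w) * exp (z • H) := by
  have hφ (u : ℂ) : HasDerivAt (fun u : ℂ => φ (exp (u • M) w)) (φ (M (exp (u • M) w))) u := by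
    have h1 := (hasDerivAt_exp_smul_const' (𝕂 := ℂ) M u).clm_apply (hasDerivAt_const u w)
    have h2 := φ.hasFDerivAt.comp_hasDerivAt u h1
    simpa [Function.comp_def] using h2
  have hH (u : ℂ) : HasDerivAt (fun u : ℂ => exp (u • H)) (exp (u • H) * H) u :=
    hasDerivAt_exp_smul_const H u
  have hH' (u : ℂ) : HasDerivAt (fun u : ℂ => exp (u • -H)) (-(H * exp (u • -H))) u := by
    simpa using hasDerivAt_exp_smul_const' (𝕂 := ℂ) (-H) u
  -- Transporting the evolved mode back by `exp (-u H)` gives a constant: the commutator produced by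
  -- the outer factors cancels the derivative of the inner one.
  have hd (u : ℂ) : HasDerivAt
      (fun u : ℂ => exp (u • -H) * φ (exp (u • M) w) * exp (u • H)) 0 u := by
    refine (((hH' u).mul (hφ u)).mul (hH u)).congr_deriv ?_
    have hc : H * exp (u • -H) = exp (u • -H) * H := by
      let _ : NormedAlgebra ℚ A := NormedAlgebra.restrictScalars ℚ ℂ A
      exact ((Commute.refl H).neg_right.smul_right u).exp_right.eq
    have hc' : exp (u • H) * H = H * exp (u • H) := by
      let _ : NormedAlgebra ℚ A := NormedAlgebra.restrictScalars ℚ ℂ A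
      exact ((Commute.refl H).smul_right u).exp_right.eq.symm
    rw [hc, hc']
    have := hM (exp (u • M) w)
    simp only [Pi.mul_apply, neg_mul, add_mul, mul_assoc]
    rw [← mul_assoc H, this]
    simp only [add_mul, mul_add, mul_assoc]
    abel
  have hconst := is_const_of_deriv_eq_zero (fun u => (hd u).differentiableAt)
    (fun u => (hd u).deriv) z 0
  simp only [zero_smul, exp_zero, one_mul, mul_one, one_apply_eq_self, smul_neg, neg_zero]
    at hconst
  rw [← hconst, ← mul_assoc, ← mul_assoc, exp_smul_mul_exp_neg_smul, one_mul]

lemma I_mul_smul_mem_skewAdjoint [NormedRing A] [NormedAlgebra ℂ A] [StarRing A] [StarModule ℂ A]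
    {a : A} (ha : IsSelfAdjoint a) (t : ℝ) : ((Complex.I * t : ℂ) • a) ∈ skewAdjoint A := by
  rw [skewAdjoint.mem_iff, star_smul, ha.star_eq, ← neg_smul]
  simp

lemma norm_exp_I_mul_smul_le [CStarAlgebra A] {a : A} (ha : IsSelfAdjoint a) (t : ℝ) :
    ‖exp ((Complex.I * t : ℂ) • a)‖ ≤ 1 := by
  let _ : NormedAlgebra ℚ A := NormedAlgebra.restrictScalars ℚ ℂ A
  nontriviality A
  exact (CStarRing.norm_of_mem_unitary
    (exp_mem_unitary_of_mem_skewAdjoint (I_mul_smul_mem_skewAdjoint ha t))).le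

/-- The unitary groups generated by two self-adjoint elements differ at time `t` by at most `|t|`
times the distance of the generators. -/
lemma norm_exp_sub_exp_le [CStarAlgebra A] {a b : A} (ha : IsSelfAdjoint a)
    (hb : IsSelfAdjoint b) (t : ℝ) :
    ‖exp ((Complex.I * t : ℂ) • a) - exp ((Complex.I * t : ℂ) • b)‖ ≤ |t| * ‖a - b‖ := by
  let _ : NormedAlgebra ℚ A := NormedAlgebra.restrictScalars ℚ ℂ A
  have key (c : A) (u : ℝ) : HasDerivAt (fun u : ℝ => exp ((Complex.I * u : ℂ) • c))
      (exp ((Complex.I * u : ℂ) • c) * (Complex.I • c)) u := by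
    have := hasDerivAt_exp_smul_const (𝕂 := ℝ) (Complex.I • c) u
    have e (v : ℝ) : v • Complex.I • c = (Complex.I * v : ℂ) • c := by
      rw [← smul_assoc, mul_comm]; simp
    simpa only [e] using this
  have key' (c : A) (u : ℝ) : HasDerivAt (fun u : ℝ => exp ((Complex.I * (-u : ℝ) : ℂ) • c))
      (-((Complex.I • c) * exp ((Complex.I * (-u : ℝ) : ℂ) • c))) u := by
    have := hasDerivAt_exp_smul_const' (𝕂 := ℝ) (-(Complex.I • c)) u
    have e (v : ℝ) : v • -(Complex.I • c) = (Complex.I * (-v : ℝ) : ℂ) • c := by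
      rw [smul_neg, ← neg_smul, ← smul_assoc, mul_comm]; simp
    simpa only [e, neg_mul] using this
  -- Duhamel's formula: the derivative is `a - b` between two unitaries, so the mean value
  -- inequality gives growth linear in `t`.
  have hd (u : ℝ) : HasDerivAt
      (fun u : ℝ => exp ((Complex.I * u : ℂ) • a) * exp ((Complex.I * (-u : ℝ) : ℂ) • b))
      (exp ((Complex.I * u : ℂ) • a) * (Complex.I • (a - b)) *
        exp ((Complex.I * (-u : ℝ) : ℂ) • b)) u := by
    refine ((key a u).mul (key' b u)).congr_deriv ?_
    simp only [smul_sub, mul_sub, sub_mul, mul_neg, mul_assoc]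
    abel
  have hbd (u : ℝ) : ‖exp ((Complex.I * u : ℂ) • a) * (Complex.I • (a - b)) *
        exp ((Complex.I * (-u : ℝ) : ℂ) • b)‖ ≤ ‖a - b‖ := by
    calc _ ≤ ‖exp ((Complex.I * u : ℂ) • a)‖ * ‖Complex.I • (a - b)‖ *
          ‖exp ((Complex.I * (-u : ℝ) : ℂ) • b)‖ :=
          (norm_mul_le _ _).trans (mul_le_mul_of_nonneg_right (norm_mul_le _ _) (norm_nonneg _))
      _ ≤ 1 * ‖a - b‖ * 1 := by
          gcongr
          · exact norm_exp_I_mul_smul_le ha u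
          · rw [norm_smul, Complex.norm_I, one_mul]
          · exact norm_exp_I_mul_smul_le hb _
      _ = ‖a - b‖ := by ring
  have hmv := convex_univ.norm_image_sub_le_of_norm_hasDerivWithin_le (x := (0 : ℝ)) (y := t)
    (fun u _ => (hd u).hasDerivWithinAt) (fun u _ => hbd u) (Set.mem_univ _) (Set.mem_univ _)
  have hinv : exp ((Complex.I * (-t : ℝ) : ℂ) • b) * exp ((Complex.I * t : ℂ) • b) = 1 := by
    have := exp_smul_mul_exp_neg_smul b (Complex.I * (-t : ℝ))
    rwa [← neg_smul, Complex.ofReal_neg, mul_neg, neg_neg, ← mul_neg, ← Complex.ofReal_neg] at this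
  have h0 : exp ((Complex.I * (0 : ℝ) : ℂ) • a) * exp ((Complex.I * (-0 : ℝ) : ℂ) • b) = 1 := by
    simp
  rw [h0, sub_zero, Real.norm_eq_abs, mul_comm ‖a - b‖] at hmv
  calc ‖exp ((Complex.I * t : ℂ) • a) - exp ((Complex.I * t : ℂ) • b)‖
      = ‖(exp ((Complex.I * t : ℂ) • a) * exp ((Complex.I * (-t : ℝ) : ℂ) • b) - 1) *
          exp ((Complex.I * t : ℂ) • b)‖ := by
        rw [sub_mul, mul_assoc, hinv, mul_one, one_mul]
    _ ≤ (|t| * ‖a - b‖) * 1 := (norm_mul_le _ _).trans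
        (mul_le_mul hmv (norm_exp_I_mul_smul_le hb t) (norm_nonneg _) (by positivity))
    _ = |t| * ‖a - b‖ := mul_one _

end Analysis

/-! ### Fourier inversion and the size of long-wave perturbations. -/

section Fourier

namespace IsingChain

/-- Fourier inversion on the ring. -/
lemma sum_fourierComponent_mul_exp {N : ℕ} [NeZero N] (δ : Fin N → ℝ) (j : Fin N) :
    ∑ p ∈ Finset.range N, fourierComponent δ p *
      Complex.exp (2 * Real.pi * Complex.I / N) ^ (p * (j : ℕ)) = δ j := by
  set ζ := Complex.exp (2 * Real.pi * Complex.I / N) with hζ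
  have hN : (N : ℂ) ≠ 0 := by exact_mod_cast NeZero.ne N
  have hprim : IsPrimitiveRoot ζ N := Complex.isPrimitiveRoot_exp N (NeZero.ne N)
  have hζ0 : ζ ≠ 0 := Complex.exp_ne_zero _
  have hexp (p : ℕ) (k : Fin N) :
      Complex.exp (-(Complex.I * (2 * (Real.pi : ℂ) * ((p : ℤ) : ℂ) / (N : ℂ)) * ((k : ℕ) : ℂ))) =
        (ζ ^ (p * (k : ℕ)))⁻¹ := by
    rw [hζ, ← Complex.exp_nat_mul, ← Complex.exp_neg]
    congr 1
    push_cast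
    ring
  -- Orthogonality of characters: for `k ≠ j` this is a full geometric sum of a nontrivial `N`-th
  -- root of unity.
  have hgeom (k : Fin N) : ∑ p ∈ Finset.range N, (ζ ^ (p * (k : ℕ)))⁻¹ * ζ ^ (p * (j : ℕ)) =
      if k = j then (N : ℂ) else 0 := by
    have hpow (p : ℕ) : (ζ ^ (p * (k : ℕ)))⁻¹ * ζ ^ (p * (j : ℕ)) =
        (ζ ^ ((j : ℤ) - (k : ℤ))) ^ p := by
      rw [← zpow_natCast ζ, ← zpow_natCast ζ, ← zpow_neg, ← zpow_add₀ hζ0, ← zpow_natCast,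
        ← zpow_mul]
      congr 1
      push_cast
      ring
    simp only [hpow]
    split_ifs with h
    · subst h; simp
    · have hne : ζ ^ ((j : ℤ) - (k : ℤ)) ≠ 1 := by
        rw [Ne, hprim.zpow_eq_one_iff_dvd]
        intro hd
        apply h
        have h1 := Int.eq_zero_of_abs_lt_dvd hd (by
          rw [abs_lt]
          have := j.2
          have := k.2
          constructor <;> omega)
        apply Fin.ext
        omega
      have h1 := geom_sum_eq hne N
      rw [h1, ← zpow_natCast, ← zpow_mul, mul_comm, zpow_mul, zpow_natCast, hprim.pow_eq_one,
        one_zpow, sub_self, zero_div]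
  simp only [fourierComponent, hexp, Finset.mul_sum, Finset.sum_mul]
  rw [Finset.sum_comm]
  have (k : Fin N) : ∑ p ∈ Finset.range N,
      (N : ℂ)⁻¹ * ((δ k : ℂ) * (ζ ^ (p * (k : ℕ)))⁻¹) * ζ ^ (p * (j : ℕ)) =
      (N : ℂ)⁻¹ * (δ k : ℂ) * if k = j then (N : ℂ) else 0 := by
    rw [← hgeom, Finset.mul_sum]
    exact Finset.sum_congr rfl fun p _ => by ring
  simp only [this, mul_ite, mul_zero, Finset.sum_ite_eq', Finset.mem_univ, if_true]
  field_simp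

/-- A long-wave perturbation is uniformly small. -/
lemma IsLongWave.abs_le {N : ℕ} [NeZero N] {P : ℕ} {K : ℝ} {δ : Fin N → ℝ}
    (hδ : IsLongWave P K δ) (j : Fin N) : |δ j| ≤ (2 * P + 1) * (K / (N : ℝ) ^ 3) := by
  have hK : 0 ≤ K / (N : ℝ) ^ 3 := (norm_nonneg _).trans (hδ.1 0)
  -- The representatives in `[0, N)` of the window `|m| ≤ P`. Residues may coincide for small `N`,
  -- which only lowers the count below `2P + 1`.
  set S := (Finset.Icc (-(P : ℤ)) P).image (fun m => (m % (N : ℤ)).toNat) with hS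
  have hcard : (S.card : ℝ) ≤ 2 * P + 1 := by
    have h1 : S.card ≤ 2 * P + 1 := by
      refine Finset.card_image_le.trans ?_
      rw [Int.card_Icc]
      omega
    exact_mod_cast h1
  have hN : (N : ℤ) ≠ 0 := by exact_mod_cast NeZero.ne N
  have hbound (p : ℕ) (hp : p ∈ Finset.range N) :
      ‖fourierComponent δ p * Complex.exp (2 * Real.pi * Complex.I / N) ^ (p * (j : ℕ))‖ ≤
        if p ∈ S then K / (N : ℝ) ^ 3 else 0 := by
    have h1 : ‖Complex.exp (2 * Real.pi * Complex.I / N)‖ = 1 :=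
      (Complex.isPrimitiveRoot_exp N (NeZero.ne N)).norm'_eq_one (NeZero.ne N)
    rw [norm_mul, norm_pow, h1, one_pow, mul_one]
    split_ifs with hpS
    · exact hδ.1 p
    · rw [hδ.2 p, norm_zero]
      intro m hm hpm
      apply hpS
      rw [hS, Finset.mem_image]
      refine ⟨m, by rw [Finset.mem_Icc]; exact _root_.abs_le.mp hm, ?_⟩
      rw [← hpm.eq, Int.emod_eq_of_lt (by omega) (by simpa using hp), Int.toNat_natCast]
  have := sum_fourierComponent_mul_exp δ j
  calc |δ j| = ‖(δ j : ℂ)‖ := by rw [Complex.norm_real, Real.norm_eq_abs]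
    _ ≤ ∑ p ∈ Finset.range N, if p ∈ S then K / (N : ℝ) ^ 3 else 0 := by
        rw [← this]
        exact norm_sum_le_of_le _ hbound
    _ ≤ ∑ p ∈ S, K / (N : ℝ) ^ 3 := by
        rw [← Finset.sum_filter]
        refine Finset.sum_le_sum_of_subset_of_nonneg ?_ fun _ _ _ => hK
        intro p hp
        exact (Finset.mem_filter.mp hp).2
    _ ≤ (2 * P + 1) * (K / (N : ℝ) ^ 3) := by
        rw [Finset.sum_const, nsmul_eq_mul]
        exact mul_le_mul_of_nonneg_right hcard hK

end IsingChain

end Fourier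

/-! ### Norms of modes and the one-particle generator. -/

noncomputable section Generator

open scoped Matrix.Norms.L2Operator MatrixOrder

namespace IsingChain

variable {N : ℕ}

lemma sum_majorana_mul_conjTranspose_add (w : EuclideanSpace ℂ (Fin N ⊕ Fin N)) :
    (∑ k, w k • majorana k) * (∑ k, w k • majorana k)ᴴ +
      (∑ k, w k • majorana k)ᴴ * (∑ k, w k • majorana k) =
      ((2 * ‖w‖ ^ 2 : ℝ) : ℂ) • (1 : Op N) := by
  have hstar : (∑ k, w k • majorana (N := N) k)ᴴ = ∑ k, star (w k) • majorana k := by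
    simp only [Matrix.conjTranspose_sum, Matrix.conjTranspose_smul, majorana_conjTranspose]
  rw [hstar, Finset.sum_mul_sum, Finset.sum_mul_sum,
    Finset.sum_comm (f := fun k l => (star (w k) • majorana k) * (w l • majorana l)),
    ← Finset.sum_add_distrib]
  have h1 (k l : Fin N ⊕ Fin N) :
      (w k • majorana k) * (star (w l) • majorana l) + (star (w l) • majorana l) *
        (w k • majorana k) = if k = l then (2 * w k * star (w l)) • (1 : Op N) else 0 := by
    rw [smul_mul_smul_comm, smul_mul_smul_comm, mul_comm (star (w l)), ← smul_add,
      majorana_anticommute]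
    split_ifs
    · rw [smul_smul]; congr 1; ring
    · rw [smul_zero]
  simp only [← Finset.sum_add_distrib, h1, Finset.sum_ite_eq, Finset.mem_univ, if_true]
  rw [← Finset.sum_smul, EuclideanSpace.norm_sq_eq]
  congr 1
  push_cast
  rw [Finset.mul_sum]
  refine Finset.sum_congr rfl fun k _ => ?_
  rw [mul_assoc]
  congr 1
  exact Complex.mul_conj' (w k)

lemma norm_one_le (N : ℕ) : ‖(1 : Op N)‖ ≤ 1 := by
  rw [← Matrix.diagonal_one, Matrix.l2_opNorm_diagonal]
  exact (pi_norm_le_iff_of_nonneg zero_le_one).mpr fun _ => by simp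

/-- Both `A A⋆` and `A⋆ A` are positive and their sum is the scalar `2 ‖w‖²`, so each is at most
this scalar. The triangle inequality would cost a factor of order `√N`. -/
lemma norm_sum_majorana_le (w : EuclideanSpace ℂ (Fin N ⊕ Fin N)) :
    ‖∑ k, w k • majorana k‖ ≤ √2 * ‖w‖ := by
  have h1 := sum_majorana_mul_conjTranspose_add w
  set A : Op N := ∑ k, w k • majorana k
  have h2 : ‖A * star A‖ ≤ ‖((2 * ‖w‖ ^ 2 : ℝ) : ℂ) • (1 : Op N)‖ := by
    refine CStarAlgebra.norm_le_norm_of_nonneg_of_le (mul_star_self_nonneg A) ?_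
    rw [← h1]
    exact le_add_of_nonneg_right (star_mul_self_nonneg A)
  rw [CStarRing.norm_self_mul_star, norm_smul, Complex.norm_real, Real.norm_eq_abs,
    abs_of_nonneg (by positivity)] at h2
  have h3 : ‖A‖ ^ 2 ≤ (√2 * ‖w‖) ^ 2 := by
    rw [mul_pow, Real.sq_sqrt (by norm_num), pow_two]
    refine h2.trans ?_
    exact mul_le_of_le_one_right (by positivity) (norm_one_le N)
  exact le_of_sq_le_sq h3 (by positivity)

/-- The mode with given coefficients in the Majorana operators. -/
def mode : EuclideanSpace ℂ (Fin N ⊕ Fin N) →L[ℂ] Op N :=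
  LinearMap.mkContinuous
    { toFun := fun w => ∑ k, w k • majorana k
      map_add' := fun v w => by simp [add_smul, Finset.sum_add_distrib]
      map_smul' := fun z w => by simp [Finset.smul_sum, smul_smul] } √2 norm_sum_majorana_le

lemma mode_apply (w : EuclideanSpace ℂ (Fin N ⊕ Fin N)) : mode w = ∑ k, w k • majorana k := rfl

lemma norm_mode_le (w : EuclideanSpace ℂ (Fin N ⊕ Fin N)) : ‖mode w‖ ≤ √2 * ‖w‖ :=
  norm_sum_majorana_le w

lemma mode_single (k : Fin N ⊕ Fin N) : mode (EuclideanSpace.single k 1) = majorana k := by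
  simp [mode_apply]

/-- The quadratic form in the Majorana operators with coefficient matrix `G`. -/
def quadraticForm (G : Matrix (Fin N ⊕ Fin N) (Fin N ⊕ Fin N) ℂ) : Op N :=
  ∑ k, ∑ l, G k l • (majorana k * majorana l)

/-- The action of a quadratic form on modes by the commutator. -/
def modeGenerator (G : Matrix (Fin N ⊕ Fin N) (Fin N ⊕ Fin N) ℂ) :
    EuclideanSpace ℂ (Fin N ⊕ Fin N) →L[ℂ] EuclideanSpace ℂ (Fin N ⊕ Fin N) :=
  Matrix.toEuclideanCLM (𝕜 := ℂ) ((2 : ℂ) • (G - Gᵀ))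

/-- Moving `majorana m` through a pair leaves two contractions of opposite sign, hence the
antisymmetrization of `G`. -/
lemma quadraticForm_mul_majorana (G : Matrix (Fin N ⊕ Fin N) (Fin N ⊕ Fin N) ℂ)
    (m : Fin N ⊕ Fin N) : quadraticForm G * majorana m =
      majorana m * quadraticForm G + ∑ k, (2 * (G k m - G m k)) • majorana k := by
  have h1 (k l : Fin N ⊕ Fin N) : majorana k * majorana l * majorana m =
      majorana m * (majorana k * majorana l) + ((if l = m then (2 : ℂ) else 0) • majorana k -
        (if k = m then (2 : ℂ) else 0) • majorana l) := by
    have e1 := majorana_anticommute l m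
    have e2 := majorana_anticommute k m
    have f1 : majorana l * majorana m = (if l = m then (2 : ℂ) else 0) • (1 : Op N) -
        majorana m * majorana l := by
      rw [eq_sub_iff_add_eq, e1]; split_ifs <;> simp
    have f2 : majorana k * majorana m = (if k = m then (2 : ℂ) else 0) • (1 : Op N) -
        majorana m * majorana k := by
      rw [eq_sub_iff_add_eq, e2]; split_ifs <;> simp
    rw [mul_assoc, f1, mul_sub, mul_smul_comm, mul_one, ← mul_assoc, f2, sub_mul, smul_mul_assoc,
      one_mul, ← mul_assoc]
    abel
  simp only [quadraticForm, Finset.sum_mul, Finset.mul_sum, smul_mul_assoc, mul_smul_comm, h1,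
    smul_add, Finset.sum_add_distrib, smul_sub, Finset.sum_sub_distrib]
  congr 1
  rw [Finset.sum_comm (f := fun k l => G k l • (if k = m then (2 : ℂ) else 0) • majorana l)]
  simp only [ite_smul, zero_smul, smul_ite, smul_zero, Finset.sum_ite_eq', Finset.mem_univ,
    if_true, smul_smul, mul_comm (2 : ℂ), ← Finset.sum_sub_distrib, ← sub_smul, sub_mul]

lemma quadraticForm_mul_mode (G : Matrix (Fin N ⊕ Fin N) (Fin N ⊕ Fin N) ℂ)
    (w : EuclideanSpace ℂ (Fin N ⊕ Fin N)) :
    quadraticForm G * mode w = mode w * quadraticForm G + mode (modeGenerator G w) := by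
  simp only [mode_apply, Finset.mul_sum, mul_smul_comm, quadraticForm_mul_majorana, smul_add,
    Finset.sum_add_distrib, Finset.sum_mul, smul_mul_assoc]
  congr 1
  simp only [Finset.smul_sum]
  rw [Finset.sum_comm]
  refine Finset.sum_congr rfl fun k _ => ?_
  simp only [smul_smul, ← Finset.sum_smul]
  congr 1
  simp only [modeGenerator, Matrix.ofLp_toEuclideanCLM, Matrix.mulVec, dotProduct]
  refine Finset.sum_congr rfl fun l _ => ?_
  simp [mul_comm]

/-- The hypothesis says that the entries of `G` are purely imaginary, and an imaginary antisymmetric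
matrix is Hermitian. -/
lemma isSelfAdjoint_modeGenerator {G : Matrix (Fin N ⊕ Fin N) (Fin N ⊕ Fin N) ℂ}
    (hG : Gᴴ = -Gᵀ) : IsSelfAdjoint (modeGenerator G) := by
  have hGt : (Gᵀ)ᴴ = -G := by
    have := congrArg Matrix.transpose hG
    rwa [Matrix.transpose_neg, Matrix.transpose_transpose] at this
  rw [isSelfAdjoint_iff, modeGenerator, ← map_star]
  congr 1
  rw [star_smul, star_sub, Matrix.star_eq_conjTranspose, Matrix.star_eq_conjTranspose, hG, hGt]
  simp only [star_ofNat]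
  congr 1
  abel

/-- The coefficients in the Majorana operators of the Ising Hamiltonian in the even sector. -/
def isingForm [NeZero N] (h : Fin N → ℝ) : Matrix (Fin N ⊕ Fin N) (Fin N ⊕ Fin N) ℂ :=
  Matrix.fromBlocks 0 (Matrix.diagonal fun i => -Complex.I * h i)
    (Matrix.of fun i j => if j = i + 1 then Complex.I * bondSign i else 0) 0

lemma isingForm_conjTranspose [NeZero N] (h : Fin N → ℝ) : (isingForm h)ᴴ = -(isingForm h)ᵀ := by
  ext k l
  rcases k with i | i <;> rcases l with j | j
  · simp [isingForm]
  · simp only [isingForm, Matrix.conjTranspose_apply, Matrix.neg_apply, Matrix.transpose_apply,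
      Matrix.fromBlocks_apply₂₁, Matrix.of_apply]
    split_ifs <;> simp
  · simp only [isingForm, Matrix.conjTranspose_apply, Matrix.neg_apply, Matrix.transpose_apply,
      Matrix.fromBlocks_apply₁₂, Matrix.diagonal_apply]
    split_ifs <;> simp
  · simp [isingForm]

lemma quadraticForm_isingForm [NeZero N] (h : Fin N → ℝ) :
    quadraticForm (isingForm h) = -∑ i, bond i + ∑ i, (h i : ℂ) • sigmaZ i := by
  simp only [quadraticForm, isingForm, Fintype.sum_sum_type, Matrix.fromBlocks_apply₁₁,
    Matrix.fromBlocks_apply₁₂, Matrix.fromBlocks_apply₂₁, Matrix.fromBlocks_apply₂₂,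
    Matrix.zero_apply, zero_smul, Finset.sum_const_zero, zero_add, add_zero,
    Matrix.diagonal_apply, Matrix.of_apply, ite_smul, Finset.sum_ite_eq, Finset.sum_ite_eq',
    Finset.mem_univ, if_true]
  rw [add_comm]
  congr 1
  · rw [← Finset.sum_neg_distrib]
    exact Finset.sum_congr rfl fun i _ => by rw [bond, ← neg_smul, neg_mul, neg_neg]
  · exact Finset.sum_congr rfl fun i _ => by rw [sigmaZ_eq, smul_smul, mul_comm]

/-- The bonds cancel and the field pairs only the two Majoranas of one site. Splitting off a fixed
unitary leaves a diagonal matrix, whose norm is a maximum over sites. -/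
lemma modeGenerator_isingForm_sub [NeZero N] (h h' : Fin N → ℝ) :
    modeGenerator (isingForm h') - modeGenerator (isingForm h) =
      Matrix.toEuclideanCLM (𝕜 := ℂ) ((2 : ℂ) •
        (Matrix.diagonal (Sum.elim (fun i => ((h' i - h i : ℝ) : ℂ))
            (fun i => ((h' i - h i : ℝ) : ℂ))) *
          Matrix.fromBlocks 0 (-Complex.I • 1) (Complex.I • 1) 0)) := by
  rw [modeGenerator, modeGenerator, ← map_sub, ← smul_sub]
  congr 2
  ext k l
  rw [Matrix.diagonal_mul]
  rcases k with i | i <;> rcases l with j | j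
  · simp [isingForm]
  · by_cases hij : i = j
    · subst hij; simp [isingForm]; ring
    · simp [isingForm, hij]
  · by_cases hij : i = j
    · subst hij; simp [isingForm]; ring
    · simp [isingForm, hij, Ne.symm hij]
  · simp [isingForm]

lemma norm_modeGenerator_isingForm_sub_le [NeZero N] (h h' : Fin N → ℝ) {D : ℝ}
    (hD : ∀ i, |h' i - h i| ≤ D) :
    ‖modeGenerator (isingForm h') - modeGenerator (isingForm h)‖ ≤ 2 * D := by
  have hD0 : 0 ≤ D := (abs_nonneg _).trans (hD 0)
  rw [modeGenerator_isingForm_sub]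
  set J : Matrix (Fin N ⊕ Fin N) (Fin N ⊕ Fin N) ℂ :=
    Matrix.fromBlocks 0 (-Complex.I • 1) (Complex.I • 1) 0 with hJ
  have hJ1 : ‖J‖ ≤ 1 := by
    have h1 : star J * J = 1 := by
      rw [Matrix.star_eq_conjTranspose, hJ, Matrix.fromBlocks_conjTranspose,
        Matrix.fromBlocks_multiply, ← Matrix.fromBlocks_one]
      simp [smul_smul]
    have h2 := CStarRing.norm_star_mul_self (x := J)
    rw [h1] at h2
    have h3 : ‖(1 : Matrix (Fin N ⊕ Fin N) (Fin N ⊕ Fin N) ℂ)‖ ≤ 1 := by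
      rw [← Matrix.diagonal_one, Matrix.l2_opNorm_diagonal]
      exact (pi_norm_le_iff_of_nonneg zero_le_one).mpr fun _ => by simp
    nlinarith [norm_nonneg J]
  rw [Matrix.l2_opNorm_toEuclideanCLM, norm_smul, Complex.norm_ofNat]
  gcongr
  refine (norm_mul_le _ _).trans ((mul_le_of_le_one_right (norm_nonneg _) hJ1).trans ?_)
  rw [Matrix.l2_opNorm_diagonal, pi_norm_le_iff_of_nonneg hD0]
  rintro (i | i) <;>
    simpa only [Sum.elim_inl, Sum.elim_inr, Complex.norm_real, Real.norm_eq_abs] using hD i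

end IsingChain

end Generator

/-! ### The even sector, Heisenberg evolution and stable operators. -/

noncomputable section Stability

open scoped Matrix.Norms.L2Operator

open NormedSpace

namespace IsingChain

variable {N : ℕ}

/-- The projection onto the states with an even number of fermions. -/
def evenProj (N : ℕ) : Op N := (2⁻¹ : ℂ) • (1 + parity N)

lemma parity_mul_self : parity N * parity N = 1 := parityOn_mul_self _

lemma norm_parity_le : ‖parity N‖ ≤ 1 := by
  have h1 := CStarRing.norm_star_mul_self (x := parity N)
  rw [Matrix.star_eq_conjTranspose, parity, parityOn_conjTranspose, parityOn_mul_self] at h1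
  rw [parity]
  nlinarith [norm_one_le N, norm_nonneg (parityOn (N := N) Finset.univ)]

lemma parity_mul_evenProj : parity N * evenProj N = evenProj N := by
  rw [evenProj, mul_smul_comm, mul_add, mul_one, parity_mul_self, add_comm]

lemma norm_evenProj_le : ‖evenProj N‖ ≤ 1 := by
  rw [evenProj, norm_smul, norm_inv, Complex.norm_ofNat]
  have := norm_add_le (1 : Op N) (parity N)
  linarith [norm_one_le N, norm_parity_le (N := N)]

lemma commute_evenProj {A : Op N} (hA : Commute A (parity N)) : Commute A (evenProj N) :=
  ((Commute.one_right A).add_right hA).smul_right _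

lemma commute_majorana_mul_majorana (k l : Fin N ⊕ Fin N) :
    Commute (majorana k * majorana l) (parity N) := by
  have h1 := parity_majorana k
  have h2 := parity_majorana l
  rw [commute_iff_eq, ← mul_assoc, h1, neg_mul, mul_assoc, mul_assoc, h2, mul_neg, neg_neg]

lemma commute_mode_mul_mode (v w : EuclideanSpace ℂ (Fin N ⊕ Fin N)) :
    Commute (mode v * mode w) (parity N) := by
  rw [mode_apply, mode_apply, Finset.sum_mul_sum]
  refine Commute.sum_left _ _ _ fun k _ => Commute.sum_left _ _ _ fun l _ => ?_
  rw [smul_mul_smul_comm]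
  exact (commute_majorana_mul_majorana k l).smul_left _

lemma commute_sigmaZ (i : Fin N) : Commute (sigmaZ i) (parity N) := by
  rw [sigmaZ_eq]
  exact (commute_majorana_mul_majorana _ _).smul_left _

lemma commute_bond [NeZero N] (i : Fin N) : Commute (bond i) (parity N) :=
  (commute_majorana_mul_majorana _ _).smul_left _

lemma commute_sigmaX_mul_sigmaX_succ [NeZero N] (i : Fin N) :
    Commute (sigmaX i * sigmaX (i + 1)) (parity N) := by
  rw [sigmaX_mul_sigmaX_succ]
  refine (commute_bond i).mul_left ?_
  split_ifs
  · exact Commute.refl _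
  · exact Commute.one_left _

lemma commute_hamiltonian [NeZero N] (h : Fin N → ℝ) : Commute (hamiltonian h) (parity N) := by
  refine Commute.add_left (Commute.neg_left ?_) ?_
  · exact Commute.sum_left _ _ _ fun i _ => commute_sigmaX_mul_sigmaX_succ i
  · exact Commute.sum_left _ _ _ fun i _ => (commute_sigmaZ i).smul_left _

lemma commute_quadraticForm (G : Matrix (Fin N ⊕ Fin N) (Fin N ⊕ Fin N) ℂ) :
    Commute (quadraticForm G) (parity N) :=
  Commute.sum_left _ _ _ fun _ _ => Commute.sum_left _ _ _ fun _ _ =>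
    (commute_majorana_mul_majorana _ _).smul_left _

/-- In the even sector the chain is a system of free fermions. -/
lemma hamiltonian_mul_evenProj [NeZero N] (h : Fin N → ℝ) :
    hamiltonian h * evenProj N = quadraticForm (isingForm h) * evenProj N := by
  rw [quadraticForm_isingForm, hamiltonian, add_mul, add_mul, neg_mul, neg_mul, Finset.sum_mul,
    Finset.sum_mul, Finset.sum_mul]
  refine congrArg₂ (· + ·) (congrArg Neg.neg (Finset.sum_congr rfl fun i _ => ?_)) rfl
  rw [sigmaX_mul_sigmaX_succ, mul_assoc]
  split_ifs
  · rw [parity_mul_evenProj]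
  · rw [one_mul]

lemma isSelfAdjoint_siteOp (i : Fin N) {a : Matrix (Fin 2) (Fin 2) ℂ} (ha : aᴴ = a) :
    IsSelfAdjoint (siteOp i a) := by
  rw [isSelfAdjoint_iff, Matrix.star_eq_conjTranspose, siteOp_conjTranspose, ha]

lemma isSelfAdjoint_sigmaX (i : Fin N) : IsSelfAdjoint (sigmaX i) :=
  isSelfAdjoint_siteOp i (by ext a b; fin_cases a <;> fin_cases b <;> simp)

lemma isSelfAdjoint_sigmaZ (i : Fin N) : IsSelfAdjoint (sigmaZ i) :=
  isSelfAdjoint_siteOp i (by ext a b; fin_cases a <;> fin_cases b <;> simp)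

lemma sigmaX_mul_self (i : Fin N) : sigmaX i * sigmaX i = 1 := by
  rw [sigmaX, siteOp_mul_siteOp, ← siteOp_one i]
  congr 1
  ext a b
  fin_cases a <;> fin_cases b <;> simp [Matrix.mul_apply]

lemma sigmaX_commute (i j : Fin N) : Commute (sigmaX i) (sigmaX j) := by
  by_cases h : i = j
  · rw [h]
  · exact siteOp_commute h _ _

lemma isSelfAdjoint_hamiltonian [NeZero N] (h : Fin N → ℝ) : IsSelfAdjoint (hamiltonian h) := by
  refine IsSelfAdjoint.add (IsSelfAdjoint.neg ?_) ?_
  · refine isSelfAdjoint_sum _ fun i _ => ?_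
    exact (IsSelfAdjoint.commute_iff (isSelfAdjoint_sigmaX _) (isSelfAdjoint_sigmaX _)).mp
      (sigmaX_commute _ _)
  · refine isSelfAdjoint_sum _ fun i _ => ?_
    exact IsSelfAdjoint.smul (Complex.conj_ofReal _) (isSelfAdjoint_sigmaZ i)

/-- The Heisenberg evolution `exp (i t H) A exp (- i t H)`. -/
def heisenberg (H : Op N) (t : ℝ) (A : Op N) : Op N :=
  exp ((Complex.I * t : ℂ) • H) * A * exp (-((Complex.I * t : ℂ) • H))

lemma exp_neg_mul_exp (x : Op N) (z : ℂ) : exp (-(z • x)) * exp (z • x) = 1 := by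
  have := exp_smul_mul_exp_neg_smul x (-z)
  rwa [neg_smul, neg_neg] at this

lemma heisenberg_mul (H : Op N) (t : ℝ) (A B : Op N) :
    heisenberg H t (A * B) = heisenberg H t A * heisenberg H t B := by
  simp only [heisenberg, mul_assoc]
  rw [← mul_assoc (exp (-((Complex.I * t : ℂ) • H))) (exp _), exp_neg_mul_exp, one_mul]

lemma heisenberg_smul (H : Op N) (t : ℝ) (z : ℂ) (A : Op N) :
    heisenberg H t (z • A) = z • heisenberg H t A := by
  simp only [heisenberg, mul_smul_comm, smul_mul_assoc]

lemma heisenberg_of_commute {H A : Op N} (h : Commute H A) (t : ℝ) : heisenberg H t A = A := by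
  let _ : NormedAlgebra ℚ (Op N) := NormedAlgebra.restrictScalars ℚ ℂ _
  rw [heisenberg, (h.smul_left _).exp_left.eq, mul_assoc, exp_smul_mul_exp_neg_smul, mul_one]

lemma heisenberg_commute {H A B : Op N} (hH : Commute H B) (hA : Commute A B) (t : ℝ) :
    Commute (heisenberg H t A) B := by
  let _ : NormedAlgebra ℚ (Op N) := NormedAlgebra.restrictScalars ℚ ℂ _
  exact ((hH.smul_left _).exp_left.mul_left hA).mul_left (hH.smul_left _).neg_left.exp_left

lemma norm_heisenberg_le {H : Op N} (hH : IsSelfAdjoint H) (t : ℝ) (A : Op N) :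
    ‖heisenberg H t A‖ ≤ ‖A‖ := by
  have h1 := norm_exp_I_mul_smul_le hH t
  have h2 := norm_exp_I_mul_smul_le hH (-t)
  rw [Complex.ofReal_neg, mul_neg, neg_smul] at h2
  calc _ ≤ ‖exp ((Complex.I * t : ℂ) • H)‖ * ‖A‖ * ‖exp (-((Complex.I * t : ℂ) • H))‖ :=
        (norm_mul_le _ _).trans (mul_le_mul_of_nonneg_right (norm_mul_le _ _) (norm_nonneg _))
    _ ≤ 1 * ‖A‖ * 1 := by gcongr
    _ = ‖A‖ := by ring

/-- Since `F` preserves the even sector and agrees there with `H`, the projection intertwines the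
two, and therefore their exponentials. -/
lemma heisenberg_mul_evenProj {H F A : Op N}
    (hF : Commute F (parity N)) (hA : Commute A (parity N))
    (h : H * evenProj N = F * evenProj N) (t : ℝ) :
    heisenberg H t A * evenProj N = evenProj N * heisenberg F t A := by
  let _ : NormedAlgebra ℚ (Op N) := NormedAlgebra.restrictScalars ℚ ℂ _
  have hs : SemiconjBy (evenProj N) F H := by
    rw [SemiconjBy, h, (commute_evenProj hF).eq]
  have h1 (z : ℂ) : SemiconjBy (evenProj N) (exp (z • F)) (exp (z • H)) := by
    refine SemiconjBy.exp_right ?_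
    rw [SemiconjBy, mul_smul_comm, hs.eq, smul_mul_assoc]
  have h2 := h1 (-(Complex.I * t : ℂ))
  rw [neg_smul, neg_smul] at h2
  exact (((h1 (Complex.I * t)).mul_right (commute_evenProj hA).symm).mul_right h2).eq.symm

lemma heisenberg_mode (G : Matrix (Fin N ⊕ Fin N) (Fin N ⊕ Fin N) ℂ) (t : ℝ)
    (w : EuclideanSpace ℂ (Fin N ⊕ Fin N)) : heisenberg (quadraticForm G) t (mode w) =
      mode (exp ((Complex.I * t : ℂ) • modeGenerator G) w) := by
  rw [heisenberg, exp_mul_map_eq_map_exp_mul mode (modeGenerator G) _ (quadraticForm_mul_mode G),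
    mul_assoc, exp_smul_mul_exp_neg_smul, mul_one]

/-- An operator of even parity which has size at most `κ`, and whose evolutions in the even sector
with the fields `h` and `h'` differ by at most `κ ε` at time `t`. -/
structure IsStable [NeZero N] (h h' : Fin N → ℝ) (t ε κ : ℝ) (A : Op N) : Prop where
  commute : Commute A (parity N)
  norm_le : ‖A‖ ≤ κ
  norm_sub_le : ‖(heisenberg (hamiltonian h') t A - heisenberg (hamiltonian h) t A) *
    evenProj N‖ ≤ κ * ε

namespace IsStable

variable [NeZero N] {h h' : Fin N → ℝ} {t ε : ℝ}

/-- Leibniz rule `A'B' - AB = A'(B' - B) + (A' - A)B`, whose two terms give the factor 2. Even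
parity of `B` lets the projection pass its evolution. -/
lemma mul {κ κ' : ℝ} {A B : Op N} (hA : IsStable h h' t ε κ A)
    (hB : IsStable h h' t ε κ' B) : IsStable h h' t ε (2 * κ * κ') (A * B) := by
  have hκ : 0 ≤ κ := (norm_nonneg _).trans hA.norm_le
  have hκ' : 0 ≤ κ' := (norm_nonneg _).trans hB.norm_le
  refine ⟨hA.commute.mul_left hB.commute, ?_, ?_⟩
  · refine (norm_mul_le _ _).trans ?_
    nlinarith [mul_le_mul hA.norm_le hB.norm_le (norm_nonneg _) hκ, mul_nonneg hκ hκ']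
  · have hc := commute_evenProj (heisenberg_commute (commute_hamiltonian h) hB.commute t)
    have h1 : (heisenberg (hamiltonian h') t (A * B) - heisenberg (hamiltonian h) t (A * B)) *
        evenProj N = heisenberg (hamiltonian h') t A *
          ((heisenberg (hamiltonian h') t B - heisenberg (hamiltonian h) t B) * evenProj N) +
        (heisenberg (hamiltonian h') t A - heisenberg (hamiltonian h) t A) * evenProj N *
          heisenberg (hamiltonian h) t B := by
      rw [mul_assoc _ (evenProj N), ← hc.eq, heisenberg_mul, heisenberg_mul]
      noncomm_ring
    rw [h1]
    refine (norm_add_le _ _).trans ((add_le_add (norm_mul_le _ _) (norm_mul_le _ _)).trans ?_)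
    have a1 := (norm_heisenberg_le (isSelfAdjoint_hamiltonian h') t A).trans hA.norm_le
    have b1 := (norm_heisenberg_le (isSelfAdjoint_hamiltonian h) t B).trans hB.norm_le
    have e1 := mul_le_mul a1 hB.norm_sub_le (norm_nonneg _) hκ
    have e2 := mul_le_mul hA.norm_sub_le b1 (norm_nonneg _)
      ((norm_nonneg _).trans hA.norm_sub_le)
    linarith

lemma smul {κ : ℝ} {A : Op N} (hA : IsStable h h' t ε κ A) {z : ℂ} (hz : ‖z‖ ≤ 1) :
    IsStable h h' t ε κ (z • A) := by
  refine ⟨hA.commute.smul_left z, ?_, ?_⟩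
  · rw [norm_smul]
    exact (mul_le_of_le_one_left (norm_nonneg _) hz).trans hA.norm_le
  · rw [heisenberg_smul, heisenberg_smul, ← smul_sub, smul_mul_assoc, norm_smul]
    exact (mul_le_of_le_one_left (norm_nonneg _) hz).trans hA.norm_sub_le

/-- Parity is conserved and equals 1 on the even sector. -/
lemma mul_parity {κ : ℝ} {A : Op N} (hA : IsStable h h' t ε κ A) :
    IsStable h h' t ε κ (A * parity N) := by
  have hκ : 0 ≤ κ := (norm_nonneg _).trans hA.norm_le
  refine ⟨hA.commute.mul_left (Commute.refl _), ?_, ?_⟩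
  · exact (norm_mul_le _ _).trans
      ((mul_le_of_le_one_right (norm_nonneg _) norm_parity_le).trans hA.norm_le)
  · rw [heisenberg_mul, heisenberg_mul, heisenberg_of_commute (commute_hamiltonian h),
      heisenberg_of_commute (commute_hamiltonian h'), ← sub_mul, mul_assoc, parity_mul_evenProj]
    exact hA.norm_sub_le

lemma one (hε : 0 ≤ ε) : IsStable h h' t ε 1 (1 : Op N) := by
  refine ⟨Commute.one_left _, norm_one_le N, ?_⟩
  rw [heisenberg_of_commute (Commute.one_right _), heisenberg_of_commute (Commute.one_right _),
    sub_self, zero_mul, norm_zero]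
  positivity

end IsStable

/-! ### Stability of modes and of spin observables. -/

lemma norm_heisenberg_mode_sub_le [NeZero N] {h h' : Fin N → ℝ} {D : ℝ}
    (hD : ∀ i, |h' i - h i| ≤ D) (t : ℝ) (w : EuclideanSpace ℂ (Fin N ⊕ Fin N)) :
    ‖heisenberg (quadraticForm (isingForm h')) t (mode w) -
      heisenberg (quadraticForm (isingForm h)) t (mode w)‖ ≤ √2 * (|t| * (2 * D) * ‖w‖) := by
  rw [heisenberg_mode, heisenberg_mode, ← map_sub]
  refine (norm_mode_le _).trans ?_
  gcongr
  have h1 := norm_exp_sub_exp_le (isSelfAdjoint_modeGenerator (isingForm_conjTranspose h'))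
    (isSelfAdjoint_modeGenerator (isingForm_conjTranspose h)) t
  have h2 := ContinuousLinearMap.le_opNorm
    (exp ((Complex.I * t : ℂ) • modeGenerator (isingForm h')) -
      exp ((Complex.I * t : ℂ) • modeGenerator (isingForm h))) w
  rw [sub_apply] at h2
  refine h2.trans ?_
  gcongr
  refine h1.trans ?_
  gcongr
  exact norm_modeGenerator_isingForm_sub_le h h' hD

lemma norm_heisenberg_mode_le [NeZero N] (h : Fin N → ℝ) (t : ℝ)
    (w : EuclideanSpace ℂ (Fin N ⊕ Fin N)) :
    ‖heisenberg (quadraticForm (isingForm h)) t (mode w)‖ ≤ √2 * ‖w‖ := by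
  rw [heisenberg_mode]
  refine (norm_mode_le _).trans ?_
  gcongr
  have h1 := norm_exp_I_mul_smul_le
    (isSelfAdjoint_modeGenerator (isingForm_conjTranspose h)) t
  exact (ContinuousLinearMap.le_opNorm _ w).trans (mul_le_of_le_one_left (norm_nonneg _) h1)

lemma isStable_mode_mul_mode [NeZero N] {h h' : Fin N → ℝ} {D : ℝ}
    (hD : ∀ i, |h' i - h i| ≤ D) (t : ℝ) (v w : EuclideanSpace ℂ (Fin N ⊕ Fin N)) :
    IsStable h h' t (|t| * (2 * D)) (4 * ‖v‖ * ‖w‖) (mode v * mode w) := by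
  have hD0 : 0 ≤ D := (abs_nonneg _).trans (hD 0)
  have hs : √2 * √2 = 2 := Real.mul_self_sqrt (by norm_num)
  refine ⟨commute_mode_mul_mode v w, ?_, ?_⟩
  · refine (norm_mul_le _ _).trans
      ((mul_le_mul (norm_mode_le v) (norm_mode_le w) (norm_nonneg _) (by positivity)).trans ?_)
    have : 0 ≤ ‖v‖ * ‖w‖ := by positivity
    calc √2 * ‖v‖ * (√2 * ‖w‖) = (√2 * √2) * (‖v‖ * ‖w‖) := by ring
      _ ≤ 4 * ‖v‖ * ‖w‖ := by rw [hs]; linarith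
  -- A single mode is odd and does not preserve the even sector. The pair is therefore transferred
  -- to the quadratic evolution first, and the Leibniz rule is applied there on the whole space.
  · rw [sub_mul, heisenberg_mul_evenProj (commute_quadraticForm _)
      (commute_mode_mul_mode v w) (hamiltonian_mul_evenProj h'),
      heisenberg_mul_evenProj (commute_quadraticForm _)
      (commute_mode_mul_mode v w) (hamiltonian_mul_evenProj h), ← mul_sub]
    refine (norm_mul_le _ _).trans
      ((mul_le_of_le_one_left (norm_nonneg _) norm_evenProj_le).trans ?_)
    rw [heisenberg_mul, heisenberg_mul]
    set a' := heisenberg (quadraticForm (isingForm h')) t (mode v) with ha'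
    set a := heisenberg (quadraticForm (isingForm h)) t (mode v) with ha
    set b' := heisenberg (quadraticForm (isingForm h')) t (mode w) with hb'
    set b := heisenberg (quadraticForm (isingForm h)) t (mode w) with hb
    have h1 : a' * b' - a * b = a' * (b' - b) + (a' - a) * b := by noncomm_ring
    rw [h1]
    refine (norm_add_le _ _).trans ((add_le_add (norm_mul_le _ _) (norm_mul_le _ _)).trans ?_)
    have e1 := mul_le_mul (norm_heisenberg_mode_le h' t v) (norm_heisenberg_mode_sub_le hD t w)
      (norm_nonneg _) (by positivity)
    have e2 := mul_le_mul (norm_heisenberg_mode_sub_le hD t v) (norm_heisenberg_mode_le h t w)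
      (norm_nonneg _) (by positivity)
    refine (add_le_add e1 e2).trans (le_of_eq ?_)
    calc √2 * ‖v‖ * (√2 * (|t| * (2 * D) * ‖w‖)) + √2 * (|t| * (2 * D) * ‖v‖) * (√2 * ‖w‖)
        = (√2 * √2) * (2 * (‖v‖ * ‖w‖) * (|t| * (2 * D))) := by ring
      _ = 4 * ‖v‖ * ‖w‖ * (|t| * (2 * D)) := by rw [hs]; ring

lemma isStable_majorana_mul_majorana [NeZero N] {h h' : Fin N → ℝ} {D : ℝ}
    (hD : ∀ i, |h' i - h i| ≤ D) (t : ℝ) (k l : Fin N ⊕ Fin N) :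
    IsStable h h' t (|t| * (2 * D)) 4 (majorana k * majorana l) := by
  have := isStable_mode_mul_mode hD t (EuclideanSpace.single k 1) (EuclideanSpace.single l 1)
  simpa [mode_single] using this

lemma isStable_sigmaZ [NeZero N] {h h' : Fin N → ℝ} {D : ℝ}
    (hD : ∀ i, |h' i - h i| ≤ D) (t : ℝ) (i : Fin N) :
    IsStable h h' t (|t| * (2 * D)) 4 (sigmaZ i) := by
  rw [sigmaZ_eq]
  exact (isStable_majorana_mul_majorana hD t _ _).smul (by simp)

lemma isStable_sigmaX_mul_sigmaX_succ [NeZero N] {h h' : Fin N → ℝ} {D : ℝ}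
    (hD : ∀ i, |h' i - h i| ≤ D) (t : ℝ) (i : Fin N) :
    IsStable h h' t (|t| * (2 * D)) 4 (sigmaX i * sigmaX (i + 1)) := by
  have hb : IsStable h h' t (|t| * (2 * D)) 4 (bond i) := by
    refine (isStable_majorana_mul_majorana hD t _ _).smul ?_
    rw [bondSign]
    split_ifs <;> simp
  rw [sigmaX_mul_sigmaX_succ]
  split_ifs
  · exact hb.mul_parity
  · rwa [mul_one]

/-- Since `σˣ` squares to 1, the correlator telescopes into `d` nearest-neighbour bonds. Each has
bound 4 and each product doubles, whence `8 ^ d`. -/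
lemma isStable_sigmaX_mul_sigmaX [NeZero N] {h h' : Fin N → ℝ} {D : ℝ}
    (hD : ∀ i, |h' i - h i| ≤ D) (t : ℝ) (d : ℕ) :
    ∀ i j : Fin N, (j : ℕ) ≡ (i : ℕ) + d [MOD N] →
      IsStable h h' t (|t| * (2 * D)) (8 ^ d) (sigmaX i * sigmaX j) := by
  have hD0 : 0 ≤ D := (abs_nonneg _).trans (hD 0)
  induction d with
  | zero =>
    intro i j hij
    have : j = i := Fin.ext (Nat.ModEq.eq_of_lt_of_lt hij j.2 i.2)
    rw [this, sigmaX_mul_self, pow_zero]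
    exact IsStable.one (by positivity)
  | succ d ih =>
    intro i j hij
    have h1 : (j : ℕ) ≡ ((i + 1 : Fin N) : ℕ) + d [MOD N] := by
      refine hij.trans ?_
      rw [Fin.val_add, Fin.val_one', Nat.add_mod_mod, show (i : ℕ) + (d + 1) = i + 1 + d by ring]
      exact (Nat.mod_modEq _ _).symm.add_right d
    have h2 := (isStable_sigmaX_mul_sigmaX_succ hD t i).mul (ih (i + 1) j h1)
    rw [mul_assoc (sigmaX i), ← mul_assoc (sigmaX (i + 1)), sigmaX_mul_self, one_mul] at h2
    convert h2 using 1
    ring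

/-- The Majorana coefficients of the mode `∑ (uᵢ cᵢ + vᵢ cᵢ†)`. -/
def majoranaCoeff (u v : Fin N → ℂ) : EuclideanSpace ℂ (Fin N ⊕ Fin N) :=
  WithLp.toLp 2 (Sum.elim (fun i => (u i + v i) / 2) (fun i => Complex.I * (u i - v i) / 2))

lemma fermionMode_eq_mode (u v : Fin N → ℂ) : fermionMode u v = mode (majoranaCoeff u v) := by
  rw [mode_apply, Fintype.sum_sum_type, ← Finset.sum_add_distrib, fermionMode]
  refine Finset.sum_congr rfl fun i _ => ?_
  simp only [majoranaCoeff, Sum.elim_inl, Sum.elim_inr, majorana, annihilate_eq_jwOp,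
    create_eq_jwOp, jwOp_smul, jwOp_add]
  congr 1
  · linear_combination ((u i - v i) / 2) * Complex.I_mul_I
  · linear_combination (-(u i - v i) / 2) * Complex.I_mul_I

lemma norm_majoranaCoeff_sq (u v : Fin N → ℂ) :
    ‖majoranaCoeff u v‖ ^ 2 = (∑ i, (‖u i‖ ^ 2 + ‖v i‖ ^ 2)) / 2 := by
  rw [EuclideanSpace.norm_sq_eq, Fintype.sum_sum_type, ← Finset.sum_add_distrib, Finset.sum_div]
  refine Finset.sum_congr rfl fun i _ => ?_
  have := parallelogram_law_with_norm ℝ (u i) (v i)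
  simp only [majoranaCoeff, Sum.elim_inl, Sum.elim_inr, norm_div, norm_mul, Complex.norm_I,
    Complex.norm_ofNat, one_mul, div_pow]
  linarith

lemma isStable_fermionMode_mul_fermionMode [NeZero N] {h h' : Fin N → ℝ} {D : ℝ}
    (hD : ∀ i, |h' i - h i| ≤ D) (t : ℝ) {u v u' v' : Fin N → ℂ} (huv : IsNormalized u v)
    (huv' : IsNormalized u' v') :
    IsStable h h' t (|t| * (2 * D)) 2 (fermionMode u v * fermionMode u' v') := by
  have h1 := isStable_mode_mul_mode hD t (majoranaCoeff u v) (majoranaCoeff u' v')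
  have e1 := norm_majoranaCoeff_sq u v
  have e2 := norm_majoranaCoeff_sq u' v'
  rw [huv] at e1
  rw [huv', ← e1] at e2
  have e3 : ‖majoranaCoeff u' v'‖ = ‖majoranaCoeff u v‖ :=
    (sq_eq_sq₀ (norm_nonneg _) (norm_nonneg _)).mp e2
  rw [fermionMode_eq_mode, fermionMode_eq_mode]
  convert h1 using 1
  rw [e3]
  linarith

/-! ### The initial state and expectation values. -/

/-- The parity interchanges the two polarized states. -/
lemma parity_mulVec_initialState : parity N *ᵥ initialState N = initialState N := by
  funext s
  rw [parity, parityOn, Matrix.mulVec_diagonal]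
  simp only [initialState, rightState, leftState, Pi.smul_apply, Pi.add_apply, smul_eq_mul,
    Finset.prod_mul_distrib]
  have h1 : (∏ j : Fin N, (-1 : ℂ) ^ (s j : ℕ)) * ∏ j : Fin N, (-1 : ℂ) ^ (s j : ℕ) = 1 := by
    rw [← Finset.prod_mul_distrib]
    exact Finset.prod_eq_one fun j _ => by rw [← mul_pow]; simp
  set q := ∏ j : Fin N, (-1 : ℂ) ^ (s j : ℕ)
  set r := ∏ _j : Fin N, ((1 / √2 : ℝ) : ℂ)
  linear_combination ((1 / √2 : ℝ) : ℂ) * r * h1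

lemma evenProj_mulVec_initialState : evenProj N *ᵥ initialState N = initialState N := by
  rw [evenProj, Matrix.smul_mulVec, Matrix.add_mulVec, Matrix.one_mulVec,
    parity_mulVec_initialState, ← two_smul ℂ, smul_smul]
  norm_num

/-- The parallelogram law replaces the overlap of the two polarized states by a crude bound, which
costs at most a factor 2. -/
lemma sum_norm_initialState_sq_le : ∑ s, ‖initialState N s‖ ^ 2 ≤ 2 := by
  have hs : (1 / √2) ^ 2 = (1 / 2 : ℝ) := by rw [div_pow, Real.sq_sqrt (by norm_num)]; norm_num
  have h1 (s : Config N) : ‖initialState N s‖ ^ 2 ≤ 2 * (1 / 2) ^ N := by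
    have hr : ‖rightState N s‖ ^ 2 = (1 / 2) ^ N := by
      simp only [rightState, Finset.prod_const, Finset.card_univ, Fintype.card_fin, norm_pow,
        Complex.norm_real, Real.norm_eq_abs, ← pow_mul, mul_comm N]
      rw [pow_mul, sq_abs, hs]
    have hl : ‖leftState N s‖ ^ 2 = (1 / 2) ^ N := by
      simp only [leftState, norm_prod, norm_mul, norm_pow, norm_neg, norm_one, one_pow, one_mul,
        Finset.prod_const, Finset.card_univ, Fintype.card_fin,
        Complex.norm_real, Real.norm_eq_abs, ← pow_mul, mul_comm N]
      rw [pow_mul, sq_abs, hs]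
    have h2 := parallelogram_law_with_norm ℝ (rightState N s) (leftState N s)
    rw [initialState, Pi.smul_apply, Pi.add_apply, norm_smul, mul_pow, Complex.norm_real,
      Real.norm_eq_abs, sq_abs, hs]
    nlinarith [norm_nonneg (rightState N s - leftState N s)]
  calc ∑ s, ‖initialState N s‖ ^ 2 ≤ ∑ _s : Config N, 2 * (1 / 2 : ℝ) ^ N :=
        Finset.sum_le_sum fun s _ => h1 s
    _ = 2 := by
        rw [Finset.sum_const, Finset.card_univ, Fintype.card_fun, Fintype.card_fin,
          Fintype.card_fin, nsmul_eq_mul]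
        push_cast
        rw [mul_left_comm, ← mul_pow]
        norm_num

lemma norm_star_dotProduct_mulVec_le (A : Op N) (v : State N) :
    ‖star v ⬝ᵥ (A *ᵥ v)‖ ≤ ‖A‖ * ∑ s, ‖v s‖ ^ 2 := by
  have h1 : star v ⬝ᵥ (A *ᵥ v) =
      inner ℂ (WithLp.toLp 2 v) (Matrix.toEuclideanCLM (𝕜 := ℂ) A (WithLp.toLp 2 v)) := by
    rw [Matrix.toEuclideanCLM_toLp, EuclideanSpace.inner_eq_star_dotProduct, dotProduct_comm]
  have h2 := ContinuousLinearMap.le_opNorm (Matrix.toEuclideanCLM (𝕜 := ℂ) A) (WithLp.toLp 2 v)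
  rw [Matrix.l2_opNorm_toEuclideanCLM] at h2
  have h3 : ∑ s, ‖v s‖ ^ 2 = ‖WithLp.toLp 2 v‖ ^ 2 := (EuclideanSpace.norm_sq_eq _).symm
  rw [h1, h3]
  refine (norm_inner_le_norm _ _).trans ?_
  nlinarith [norm_nonneg (WithLp.toLp 2 v)]

lemma expect_eq_heisenberg [NeZero N] (h : Fin N → ℝ) (t : ℝ) (A : Op N) :
    expect h t A =
      star (initialState N) ⬝ᵥ (heisenberg (hamiltonian h) t A *ᵥ initialState N) := by
  have hU : (exp ((-(Complex.I * (t : ℂ))) • hamiltonian h))ᴴ =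
      exp ((Complex.I * (t : ℂ)) • hamiltonian h) := by
    let _ : NormedAlgebra ℚ (Op N) := NormedAlgebra.restrictScalars ℚ ℂ _
    rw [← Matrix.star_eq_conjTranspose, star_exp, star_smul,
      (isSelfAdjoint_hamiltonian h).star_eq]
    simp
  rw [expect, stateAt, Matrix.star_mulVec, ← Matrix.dotProduct_mulVec, hU, heisenberg,
    Matrix.mulVec_mulVec, Matrix.mulVec_mulVec, neg_smul, mul_assoc]

/-- The projection can be inserted for free because it fixes the initial state. The factor 2 is the
bound on the squared norm of that state. -/
lemma IsStable.norm_change_le [NeZero N] {h : ℝ} {δ : Fin N → ℝ} {t ε κ : ℝ} {A : Op N}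
    (hA : IsStable (fun _ => h) (fun j => h + δ j) t ε κ A) :
    ‖change h δ t A‖ ≤ 2 * (κ * ε) := by
  have h1 : change h δ t A = star (initialState N) ⬝ᵥ
      (((heisenberg (hamiltonian fun j => h + δ j) t A - heisenberg (hamiltonian fun _ => h) t A) *
        evenProj N) *ᵥ initialState N) := by
    rw [change, expect_eq_heisenberg, expect_eq_heisenberg, ← dotProduct_sub, ← Matrix.sub_mulVec,
      ← Matrix.mulVec_mulVec, evenProj_mulVec_initialState]
  rw [h1]
  refine (norm_star_dotProduct_mulVec_le _ _).trans ?_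
  rw [mul_comm]
  exact mul_le_mul sum_norm_initialState_sq_le hA.norm_sub_le (norm_nonneg _) zero_le_two

lemma annihilate_eq_fermionMode (i : Fin N) : annihilate i = fermionMode (Pi.single i 1) 0 := by
  simp [fermionMode, Pi.single_apply]

lemma create_eq_fermionMode (i : Fin N) : create i = fermionMode 0 (Pi.single i 1) := by
  simp [fermionMode, Pi.single_apply]

lemma isNormalized_single_zero (i : Fin N) : IsNormalized (Pi.single i 1) 0 := by
  simp [IsNormalized, Pi.single_apply, apply_ite]

lemma isNormalized_zero_single (i : Fin N) : IsNormalized 0 (Pi.single i 1) := by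
  simp [IsNormalized, Pi.single_apply, apply_ite]

end IsingChain

end Stability

theorem theorem2 (h : ℝ) (hh : 1 < h) (P : ℕ) (K T : ℝ) :
    (∃ C : ℝ, ∀ (N : ℕ) [NeZero N] (δ : Fin N → ℝ), IsingChain.IsLongWave P K δ →
      ∀ t : ℝ, |t| ≤ T * (N : ℝ) ^ 2 →
        (∀ i j : Fin N,
          ‖IsingChain.change h δ t (IsingChain.annihilate i * IsingChain.annihilate j)‖ ≤ C / N ∧
          ‖IsingChain.change h δ t (IsingChain.annihilate i * IsingChain.create j)‖ ≤ C / N ∧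
          ‖IsingChain.change h δ t (IsingChain.create i * IsingChain.annihilate j)‖ ≤ C / N ∧
          ‖IsingChain.change h δ t (IsingChain.create i * IsingChain.create j)‖ ≤ C / N) ∧
        (∀ u v u' v' : Fin N → ℂ,
          IsingChain.IsNormalized u v → IsingChain.IsNormalized u' v' →
          ‖IsingChain.change h δ t
            (IsingChain.fermionMode u v * IsingChain.fermionMode u' v')‖ ≤ C / N) ∧
        (∀ i j : Fin N,
          ‖IsingChain.change h δ t (IsingChain.sigmaZ i * IsingChain.sigmaZ j)‖ ≤ C / N)) ∧
    (∀ d : ℕ, ∃ C : ℝ, ∀ (N : ℕ) [NeZero N] (δ : Fin N → ℝ), IsingChain.IsLongWave P K δ →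
      ∀ t : ℝ, |t| ≤ T * (N : ℝ) ^ 2 →
        ∀ i j : Fin N, (j : ℕ) ≡ (i : ℕ) + d [MOD N] →
          ‖IsingChain.change h δ t (IsingChain.sigmaX i * IsingChain.sigmaX j)‖ ≤ C / N) := by
  have hfields (N : ℕ) [NeZero N] (δ : Fin N → ℝ) (hδ : IsingChain.IsLongWave P K δ) (i : Fin N) :
      |(h + δ i) - h| ≤ (2 * P + 1) * (K / (N : ℝ) ^ 3) := by
    rw [add_sub_cancel_left]
    exact hδ.abs_le i
  have hstable (N : ℕ) [NeZero N] (δ : Fin N → ℝ) (hδ : IsingChain.IsLongWave P K δ) (t : ℝ)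
      (ht : |t| ≤ T * (N : ℝ) ^ 2) (κ κ' : ℝ) (hκ : κ ≤ κ') (hκ' : 0 ≤ κ') (A : IsingChain.Op N)
      (hA : IsingChain.IsStable (fun _ => h) (fun j => h + δ j) t
        (|t| * (2 * ((2 * P + 1) * (K / (N : ℝ) ^ 3)))) κ A) :
      ‖IsingChain.change h δ t A‖ ≤ (4 * κ' * (2 * P + 1) * T * K) / N := by
    have hN : (N : ℝ) ≠ 0 := by exact_mod_cast NeZero.ne N
    -- The bound at wave number `0` already forces the right sign of `K`.
    have hK : 0 ≤ K / (N : ℝ) ^ 3 := (norm_nonneg _).trans (hδ.1 0)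
    calc _ ≤ 2 * (κ * (|t| * (2 * ((2 * P + 1) * (K / (N : ℝ) ^ 3))))) := hA.norm_change_le
      _ ≤ 2 * (κ' * (T * (N : ℝ) ^ 2 * (2 * ((2 * P + 1) * (K / (N : ℝ) ^ 3))))) := by gcongr
      _ = (4 * κ' * (2 * P + 1) * T * K) / N := by field_simp; ring
  -- The value `32 = 2 * 4 * 4` comes from the product of two `σᶻ` and dominates the 2 needed for
  -- normalized modes.
  refine ⟨⟨4 * 32 * (2 * P + 1) * T * K, fun N _ δ hδ t ht => ?_⟩,
    fun d => ⟨4 * 8 ^ d * (2 * P + 1) * T * K, fun N _ δ hδ t ht i j hij => ?_⟩⟩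
  · have hmodes (u v u' v' : Fin N → ℂ) (huv : IsingChain.IsNormalized u v)
        (huv' : IsingChain.IsNormalized u' v') := hstable N δ hδ t ht 2 32 (by norm_num)
          (by norm_num) _ (IsingChain.isStable_fermionMode_mul_fermionMode (hfields N δ hδ) t huv
            huv')
    refine ⟨fun i j => ?_, hmodes, fun i j => ?_⟩
    · simp only [IsingChain.annihilate_eq_fermionMode, IsingChain.create_eq_fermionMode]
      have ha := IsingChain.isNormalized_single_zero (N := N)
      have hc := IsingChain.isNormalized_zero_single (N := N)
      exact ⟨hmodes _ _ _ _ (ha i) (ha j), hmodes _ _ _ _ (ha i) (hc j),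
        hmodes _ _ _ _ (hc i) (ha j), hmodes _ _ _ _ (hc i) (hc j)⟩
    · exact hstable N δ hδ t ht (2 * 4 * 4) 32 (by norm_num) (by norm_num) _
        ((IsingChain.isStable_sigmaZ (hfields N δ hδ) t i).mul
          (IsingChain.isStable_sigmaZ (hfields N δ hδ) t j))
  · exact hstable N δ hδ t ht (8 ^ d) (8 ^ d) le_rfl (by positivity) _
      (IsingChain.isStable_sigmaX_mul_sigmaX (hfields N δ hδ) t d i j hij)
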